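/- Consider $n\ge 2$ deterministic processes with unique identifiers, which may fail only by crashing, in an asynchronous system in which they communicate either by atomic read/write registers (multi-writer multi-reader, any number of them) or by sending and receiving messages (reliable, with unbounded delays). Each process has an input from a set of $m\ge 2$ possible input values. An $(n,k)$-partial agreement algorithm that tolerates $t$ crash failures is an algorithm such that: - (Agreement and weak validity) in every execution there is a value $v$, which is the input of at least one process, such that the number of processes that decide on $v$ plus the number of processes that have not decided is at least $k$; in particular, when all $n$ processes decide, at least $k$ of them decide on $v$. - ($t$-resiliency) in every execution in which at most $t$ processes crash, each process that does not crash eventually decides and terminates. With strong validity in place of weak validity, it is required instead of "$v$ is the input of at least one process" that every decided value is the input of at least one process. Then for all $n\ge 2$, $m\ge 2$ and $t\ge 1$, under either validity requirement and in either communication model, an $(n,k)$-partial agreement algorithm that tolerates $t$ crash failures exists only if $k\le\lceil n/2\rceil$. -/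

import Mathlib

universe u w

/-! ### Executions and the partial agreement problem -/

/-- The part of an execution of `n` processes that the problem specification refers to.
Time is discrete; at each time at most one process takes a step (`none`: nobody does). -/
structure Execution (n : ℕ) (V : Type u) where
  /-- The process that takes a step at the given time, if any. -/
  mover : ℕ → Option (Fin n)
  /-- The value that a process has decided (returned) by the given time, if any. -/
  decision : ℕ → Fin n → Option V

namespace Execution

variable {n : ℕ} {V : Type u}

/-- Process `p` eventually decides and terminates. -/
def Decides (E : Execution n V) (p : Fin n) : Prop :=
  ∃ τ v, E.decision τ p = some v

/-- Process `p` crashes: it halts prematurely, that is, it stops taking steps at some point and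
never returns from its operation. -/
def Crashes (E : Execution n V) (p : Fin n) : Prop :=
  ¬ E.Decides p ∧ ∃ T, ∀ τ, T ≤ τ → E.mover τ ≠ some p

/-- `t`-resiliency: if at most `t` processes crash, every process that does not crash
eventually decides and terminates. -/
def Resilient (E : Execution n V) (t : ℕ) : Prop :=
  {p | E.Crashes p}.ncard ≤ t → ∀ p, ¬ E.Crashes p → E.Decides p

end Execution

/-- The two validity requirements. -/
inductive Validity where
  | weak
  | strong

/-- Validity of the decisions `d` and the distinguished value `v`, for inputs `x`.
Weak: `v` is an input of some process. Strong: every decided value is an input. -/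
def Validity.Holds {n : ℕ} {V : Type u} (val : Validity) (x : Fin n → V)
    (d : Fin n → Option V) (v : V) : Prop :=
  match val with
  | .weak => ∃ p, x p = v
  | .strong => ∀ p v', d p = some v' → ∃ q, x q = v'

/-- Agreement and validity of the decisions `d` made so far: for some value `v`, the processes
that decided `v` together with those that have not decided are at least `k` in number
(so that at most `n - k` processes decided on other values), and validity holds. -/
def PartiallyAgree {n : ℕ} {V : Type u} (k : ℕ) (val : Validity) (x : Fin n → V)
    (d : Fin n → Option V) : Prop :=
  ∃ v, k ≤ {p | d p = some v ∨ d p = none}.ncard ∧ val.Holds x d v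

/-- The status of a process: still running, in some local state, or returned with a decision. -/
inductive Status (S : Type w) (V : Type u) where
  | running (s : S)
  | returned (v : V)

/-- The decision of a process, if it has returned. -/
def Status.decision {S : Type w} {V : Type u} : Status S V → Option V
  | .running _ => none
  | .returned v => some v

/-! ### Asynchronous read/write shared memory -/

/-- The atomic step that a running process is about to take: read a register and continue
according to the value read, write a value to a register, or return a decision. -/
inductive RWAction (S R W : Type w) (V : Type u) where
  | read (r : R) (next : W → S)
  | write (r : R) (val : W) (next : S)
  | ret (v : V)

/-- A deterministic algorithm for `n` processes with atomic (multi-writer multi-reader)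
registers. The number of registers, their contents and the local states are unrestricted. -/
structure RWAlgorithm (n : ℕ) (V : Type u) where
  /-- Local states. -/
  State : Type w
  /-- Names of the registers. -/
  Reg : Type w
  /-- Values that registers can hold. -/
  Val : Type w
  /-- Contents of the registers at the start. -/
  startMem : Reg → Val
  /-- Local state of a process at the start, given its input. -/
  start : Fin n → V → State
  /-- The code of each process. -/
  code : Fin n → State → RWAction State Reg Val V

namespace RWAlgorithm

variable {n : ℕ} {V : Type u}

/-- A global configuration. -/
structure Config (A : RWAlgorithm.{u, w} n V) where
  status : Fin n → Status A.State V
  mem : A.Reg → A.Val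

variable (A : RWAlgorithm.{u, w} n V)

/-- The configuration at the start, for the inputs `x`. -/
def startConfig (x : Fin n → V) : A.Config where
  status p := .running (A.start p (x p))
  mem := A.startMem

open Classical in
/-- The configuration after process `p` takes a step. -/
noncomputable def step (C : A.Config) (p : Fin n) : A.Config :=
  match C.status p with
  | .returned _ => C
  | .running s =>
    match A.code p s with
    | .read r next => ⟨Function.update C.status p (.running (next (C.mem r))), C.mem⟩
    | .write r a s' =>
        ⟨Function.update C.status p (.running s'), Function.update C.mem r a⟩
    | .ret v => ⟨Function.update C.status p (.returned v), C.mem⟩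

/-- The configuration at each time, if the processes are scheduled as in `σ`. -/
noncomputable def config (x : Fin n → V) (σ : ℕ → Option (Fin n)) : ℕ → A.Config
  | 0 => A.startConfig x
  | τ + 1 =>
    match σ τ with
    | none => config x σ τ
    | some p => A.step (config x σ τ) p

/-- The execution with inputs `x` and schedule `σ`. -/
noncomputable def execution (x : Fin n → V) (σ : ℕ → Option (Fin n)) : Execution n V where
  mover := σ
  decision τ p := ((A.config x σ τ).status p).decision

/-- `A` is an `(n,k)`-partial agreement algorithm that tolerates `t` crash failures when the
set of possible inputs is `I`. -/
def SolvesPartialAgreement (I : Set V) (t k : ℕ) (val : Validity) : Prop :=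
  ∀ x : Fin n → V, (∀ p, x p ∈ I) → ∀ σ : ℕ → Option (Fin n),
    (∀ τ, PartiallyAgree k val x ((A.execution x σ).decision τ)) ∧
    (A.execution x σ).Resilient t

end RWAlgorithm

/-! ### Asynchronous message passing -/

/-- A deterministic algorithm for `n` processes that communicate by messages. In one step a
process receives at most one message, changes its state or returns a decision, and sends
finitely many messages, each to a process of its choice. -/
structure MPAlgorithm (n : ℕ) (V : Type u) where
  /-- Local states. -/
  State : Type w
  /-- Contents of messages. -/
  Msg : Type w
  /-- Local state of a process at the start, given its input. -/
  start : Fin n → V → State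
  /-- The code of each process: from the local state and the message received, if any, the new
  status and the list of messages sent, with their destinations. -/
  code : Fin n → State → Option Msg → Status State V × List (Fin n × Msg)

/-- The identity of a message: the `i`-th message (from `i = 0`) sent by a process `q` is
`(q, i)`. -/
abbrev MsgId (n : ℕ) : Type := Fin n × ℕ

namespace MPAlgorithm

variable {n : ℕ} {V : Type u}

/-- A global configuration: the status of each process, the list of all messages that each
process has sent, with their destinations, and the messages received so far. -/
structure Config (A : MPAlgorithm.{u, w} n V) where
  status : Fin n → Status A.State V
  sent : Fin n → List (Fin n × A.Msg)
  received : Finset (MsgId n)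

variable (A : MPAlgorithm.{u, w} n V)

/-- The configuration at the start, for the inputs `x`. -/
def startConfig (x : Fin n → V) : A.Config where
  status p := .running (A.start p (x p))
  sent _ := []
  received := ∅

variable {A}

/-- What process `p` receives if the scheduler hands it the message `o`: the content of this
message if it has been sent to `p` and not been received before, and nothing otherwise. -/
def Config.delivery (C : A.Config) (p : Fin n) : Option (MsgId n) → Option A.Msg
  | none => none
  | some id =>
    if id ∈ C.received then none
    else ((C.sent id.1)[id.2]?).bind fun m => if m.1 = p then some m.2 else none

/-- The message `id` has been sent to `p` and not been received. -/
def Config.InTransit (C : A.Config) (id : MsgId n) (p : Fin n) : Prop :=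
  id ∉ C.received ∧ ∃ a, (C.sent id.1)[id.2]? = some (p, a)

variable (A)

/-- The configuration after process `p` takes a step in which the scheduler hands it the
message `o`, if any. -/
def step (C : A.Config) (p : Fin n) (o : Option (MsgId n)) : A.Config :=
  match C.status p with
  | .returned _ => C
  | .running s =>
    let out := A.code p s (C.delivery p o)
    { status := Function.update C.status p out.1
      sent := Function.update C.sent p (C.sent p ++ out.2)
      received :=
        match C.delivery p o, o with
        | some _, some id => insert id C.received
        | _, _ => C.received }

/-- The configuration at each time, under the schedule `σ`. -/
def config (x : Fin n → V) (σ : ℕ → Option (Fin n × Option (MsgId n))) :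
    ℕ → A.Config
  | 0 => A.startConfig x
  | τ + 1 =>
    match σ τ with
    | none => config x σ τ
    | some (p, o) => A.step (config x σ τ) p o

/-- The execution with inputs `x` and schedule `σ`. -/
def execution (x : Fin n → V) (σ : ℕ → Option (Fin n × Option (MsgId n))) :
    Execution n V where
  mover τ := (σ τ).map Prod.fst
  decision τ p := ((A.config x σ τ).status p).decision

/-- Messages are not lost: each message sent to a process that neither crashes nor terminates
is eventually received. -/
def Reliable (x : Fin n → V) (σ : ℕ → Option (Fin n × Option (MsgId n))) : Prop :=
  ∀ τ id p, (A.config x σ τ).InTransit id p →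
    (A.execution x σ).Crashes p ∨ (A.execution x σ).Decides p ∨
      ∃ τ', id ∈ (A.config x σ τ').received

/-- `A` is an `(n,k)`-partial agreement algorithm that tolerates `t` crash failures when the
set of possible inputs is `I`. -/
def SolvesPartialAgreement (I : Set V) (t k : ℕ) (val : Validity) : Prop :=
  ∀ x : Fin n → V, (∀ p, x p ∈ I) → ∀ σ : ℕ → Option (Fin n × Option (MsgId n)),
    (∀ τ, PartiallyAgree k val x ((A.execution x σ).decision τ)) ∧
    (A.Reliable x σ → (A.execution x σ).Resilient t)

end MPAlgorithm

/-!
Let `k > ⌈n / 2⌉`, that is, `n + 1 < 2 * k`. Call a value chosen once more than `n - k` processes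
have decided it. Agreement leaves at most `n - k` deciders to values other than the distinguished
one, so a chosen value is the distinguished one: it is unique, it remains chosen, and it is an
input under either validity requirement. Once `n - 1` processes have decided, the distinguished
value has at least `k - 1 > n - k` deciders, so it is chosen (`exists_chosen`). Hence choosing a
value amounts to consensus in spite of one crash, and the bivalence argument of Fischer, Lynch and
Paterson rules it out.

The argument is carried out once, for the abstract `AsyncSystem`, and applied to both communication
models. A configuration is bivalent if two different values can still be chosen. The `n - 1`
processes other than `s` can choose a value without `s`, and they choose the same one from all
configurations that simulate a common configuration for them (`Solves.exists_common_value`). This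
yields a bivalent start (`Solves.exists_bivalent_start`), and, given a bivalent configuration and
an event `e`, a way to schedule `e` and stay bivalent (`Solves.exists_bivalent_step`). So there is
a fair schedule that stays bivalent forever (`exists_fair_bivalent_schedule`); but in a fair
schedule a value is chosen (`not_solves`).

The one law of an `AsyncSystem` that depends on the model is `local_sim`: the configurations after
`e` and after `f, e` can be continued to configurations that simulate a common one for all but one
process. In shared memory, simulation is equality except for the local state of `s`, and the law
is the case distinction between reads and writes (`RWAlgorithm.exists_simExcept`). With messages,
`X` simulates `Z` even if `s` sent more messages in `X`; since the other processes may leave these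
undelivered, a step of `s` itself never destroys simulation (`MPAlgorithm.SimExcept.step_right`),
and `local_sim` follows without commuting any steps.
-/

open Relation

/-! ### Chosen values -/

/-- The value `v` has so many deciders that, under `PartiallyAgree k`, no other value can be the
value distinguished by agreement: more than `n - k` processes decided `v`. -/
def Chosen {n : ℕ} {V : Type u} (k : ℕ) (d : Fin n → Option V) (v : V) : Prop :=
  n < k + {p | d p = some v}.ncard

section Chosen

variable {n k : ℕ} {V : Type u} {val : Validity} {x : Fin n → V} {d : Fin n → Option V} {v w : V}

/-- The at least `k` processes that decided `w` or nothing leave at most `n - k` for another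
value. -/
theorem Chosen.eq_of_le_ncard (h : Chosen k d v)
    (hw : k ≤ {p | d p = some w ∨ d p = none}.ncard) : v = w := by
  by_contra hne
  have hdisj : Disjoint {p | d p = some w ∨ d p = none} {p | d p = some v} := by
    rw [Set.disjoint_left]
    rintro p (hp | hp) hp' <;> simp_all
  have h1 := Set.ncard_union_eq hdisj
  have h2 := Set.ncard_le_card ({p | d p = some w ∨ d p = none} ∪ {p | d p = some v})
  rw [Nat.card_eq_fintype_card, Fintype.card_fin] at h2
  unfold Chosen at h
  omega

theorem Chosen.unique (h : PartiallyAgree k val x d) (hv : Chosen k d v) (hw : Chosen k d w) :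
    v = w := by
  obtain ⟨u, hu, -⟩ := h
  rw [hv.eq_of_le_ncard hu, hw.eq_of_le_ncard hu]

theorem Chosen.exists_input (h : PartiallyAgree k val x d) (hv : Chosen k d v) :
    ∃ p, x p = v := by
  obtain ⟨u, hu, hval⟩ := h
  obtain rfl := hv.eq_of_le_ncard hu
  cases val with
  | weak => exact hval
  | strong =>
    have hk : k ≤ n := by
      have h2 := Set.ncard_le_card {p | d p = some v ∨ d p = none}
      rw [Nat.card_eq_fintype_card, Fintype.card_fin] at h2
      omega
    have hpos : 0 < {p | d p = some v}.ncard := by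
      unfold Chosen at hv
      omega
    obtain ⟨p, hp⟩ := (Set.ncard_pos).1 hpos
    exact hval p v hp

/-- Once all processes but `s` have decided, some value is chosen, even if the decision of `s` is
disregarded. This is where `k > ⌈n / 2⌉` enters. -/
theorem exists_chosen (hk : n + 1 < 2 * k) (h : PartiallyAgree k val x d) (s : Fin n)
    (hd : ∀ p, p ≠ s → d p ≠ none) :
    ∃ v, n < k + {p | p ≠ s ∧ d p = some v}.ncard := by
  obtain ⟨v, hv, -⟩ := h
  refine ⟨v, ?_⟩
  have hsub : {p | d p = some v ∨ d p = none} ⊆ insert s {p | p ≠ s ∧ d p = some v} := by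
    intro p hp
    by_cases hps : p = s
    · exact Or.inl hps
    · exact Or.inr ⟨hps, hp.resolve_right (hd p hps)⟩
  have h1 := Set.ncard_le_ncard hsub
  have h2 := Set.ncard_insert_le s {p | p ≠ s ∧ d p = some v}
  omega

theorem Chosen.of_imp {d' : Fin n → Option V} (h : Chosen k d v)
    (hd : ∀ p, d p = some v → d' p = some v) : Chosen k d' v :=
  lt_of_lt_of_le h (Nat.add_le_add_left (Set.ncard_le_ncard hd) k)

end Chosen

/-! ### Asynchronous systems -/

/-- What the impossibility argument uses of a model of asynchronous computation: a transition
system whose events are performed by at most one process each. The relation `Sim s Z X` says that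
the processes other than `s` can do from `X` whatever they can do, without `s`, from `Z`. -/
structure AsyncSystem (n : ℕ) (V : Type u) where
  /-- Global configurations. -/
  Conf : Type w
  /-- Events that a scheduler can choose. -/
  Event : Type
  /-- The event in which nobody takes a step. -/
  idle : Event
  /-- The process that performs an event. -/
  proc : Event → Option (Fin n)
  /-- The configuration at the start, given the inputs. -/
  start : (Fin n → V) → Conf
  /-- The effect of an event. -/
  step : Conf → Event → Conf
  /-- The values decided so far. -/
  decision : Conf → Fin n → Option V
  /-- `Sim s Z X`: the processes other than `s` can do from `X` whatever they can do from `Z`. -/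
  Sim : Fin n → Conf → Conf → Prop
  countable_event : Countable Event
  proc_idle : proc idle = none
  /-- Decisions are irrevocable. -/
  decision_step : ∀ C e p v, decision C p = some v → decision (step C e) p = some v
  sim_start : ∀ s x y, (∀ p, p ≠ s → x p = y p) → Sim s (start x) (start y)
  sim_step : ∀ s Z X e, Sim s Z X → proc e ≠ some s →
    ∃ e', Sim s (step Z e) (step X e')
  sim_decision : ∀ s Z X p, Sim s Z X → p ≠ s → decision Z p = decision X p
  /-- The effect of scheduling `f` before `e` can be hidden from all processes but one: after `e`
  and after `f, e` there are configurations that simulate a common one. -/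
  local_sim : ∀ D e f, ∃ s Z X Y,
    ReflTransGen (fun C C' => ∃ g, step C g = C') D Z ∧
    ReflTransGen (fun C C' => ∃ g, step C g = C') (step D e) X ∧
    ReflTransGen (fun C C' => ∃ g, step C g = C') (step (step D f) e) Y ∧
    Sim s Z X ∧ Sim s Z Y

namespace AsyncSystem

variable {n k : ℕ} {V : Type u} (S : AsyncSystem.{u, w} n V)

/-- Reachability in finitely many events. -/
def Reach : S.Conf → S.Conf → Prop :=
  ReflTransGen fun C C' => ∃ e, S.step C e = C'

/-- Reachability in finitely many events, none of them performed by `s`. -/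
def ReachWithout (s : Fin n) : S.Conf → S.Conf → Prop :=
  ReflTransGen fun C C' => ∃ e, S.proc e ≠ some s ∧ S.step C e = C'

/-- The configuration at each time under the schedule `σ`. -/
def run (x : Fin n → V) (σ : ℕ → S.Event) : ℕ → S.Conf
  | 0 => S.start x
  | τ + 1 => S.step (run x σ τ) (σ τ)

/-- Every event occurs infinitely often, except possibly those of `s` if `s` stops. -/
def FairExcept (s : Fin n) (σ : ℕ → S.Event) : Prop :=
  ∀ e, (∀ T, ∃ τ, T ≤ τ ∧ σ τ = e) ∨
    (S.proc e = some s ∧ ∃ T, ∀ τ, T ≤ τ → S.proc (σ τ) ≠ some s)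

/-- The system solves `(n,k)`-partial agreement for inputs in `I`, with resilience to one crash
restricted to fair schedules. -/
structure Solves (I : Set V) (k : ℕ) (val : Validity) : Prop where
  agree : ∀ x, (∀ p, x p ∈ I) → ∀ σ τ, PartiallyAgree k val x (S.decision (S.run x σ τ))
  live : ∀ x, (∀ p, x p ∈ I) → ∀ σ s, S.FairExcept s σ →
    ∀ p, p ≠ s → ∃ τ, S.decision (S.run x σ τ) p ≠ none

/-- The value `v` is chosen in some configuration reachable from `C`. -/
def CanChoose (k : ℕ) (C : S.Conf) (v : V) : Prop :=
  ∃ D, S.Reach C D ∧ Chosen k (S.decision D) v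

/-- Two different values can still be chosen from `C`. -/
def Bivalent (k : ℕ) (C : S.Conf) : Prop :=
  ∃ v w, v ≠ w ∧ S.CanChoose k C v ∧ S.CanChoose k C w

variable {S}

theorem reach_step (C : S.Conf) (e : S.Event) : S.Reach C (S.step C e) :=
  ReflTransGen.single ⟨e, rfl⟩

theorem CanChoose.of_reach {C D : S.Conf} {v : V} (h : S.Reach C D) (hD : S.CanChoose k D v) :
    S.CanChoose k C v :=
  let ⟨W, hW, hv⟩ := hD
  ⟨W, h.trans hW, hv⟩

theorem Bivalent.of_reach {C D : S.Conf} (h : S.Reach C D) (hD : S.Bivalent k D) :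
    S.Bivalent k C :=
  let ⟨v, w, hne, hv, hw⟩ := hD
  ⟨v, w, hne, hv.of_reach h, hw.of_reach h⟩

theorem decision_of_reach {C D : S.Conf} (h : S.Reach C D) {p : Fin n} {v : V}
    (hC : S.decision C p = some v) : S.decision D p = some v := by
  induction h with
  | refl => exact hC
  | tail _ h ih =>
    obtain ⟨e, rfl⟩ := h
    exact S.decision_step _ e p v ih

theorem chosen_of_reach {C D : S.Conf} (h : S.Reach C D) {v : V}
    (hC : Chosen k (S.decision C) v) : Chosen k (S.decision D) v :=
  hC.of_imp fun _ => decision_of_reach h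

/-! ### Schedules -/

section Schedules

variable {x : Fin n → V}

theorem run_congr {σ σ' : ℕ → S.Event} {τ : ℕ} (h : ∀ j, j < τ → σ' j = σ j) :
    S.run x σ' τ = S.run x σ τ := by
  induction τ with
  | zero => rfl
  | succ τ ih =>
    simp only [run]
    rw [ih fun j hj => h j (by omega), h τ (by omega)]

theorem reach_run (σ : ℕ → S.Event) {τ τ' : ℕ} (h : τ ≤ τ') :
    S.Reach (S.run x σ τ) (S.run x σ τ') := by
  induction τ', h using Nat.le_induction with
  | base => exact ReflTransGen.refl
  | succ m _ ih => exact ReflTransGen.tail ih ⟨σ m, rfl⟩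

theorem reachWithout_run {s : Fin n} {σ : ℕ → S.Event} {τ τ' : ℕ}
    (hs : ∀ j, τ ≤ j → S.proc (σ j) ≠ some s) (h : τ ≤ τ') :
    S.ReachWithout s (S.run x σ τ) (S.run x σ τ') := by
  induction τ', h using Nat.le_induction with
  | base => exact ReflTransGen.refl
  | succ m hm ih => exact ReflTransGen.tail ih ⟨σ m, hs m hm, rfl⟩

theorem exists_schedule_of_reach {σ : ℕ → S.Event} {τ : ℕ} {D : S.Conf}
    (h : S.Reach (S.run x σ τ) D) :
    ∃ σ' τ', τ ≤ τ' ∧ (∀ j, j < τ → σ' j = σ j) ∧ S.run x σ' τ' = D := by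
  induction h with
  | refl => exact ⟨σ, τ, le_rfl, fun _ _ => rfl, rfl⟩
  | tail _ h ih =>
    obtain ⟨e, rfl⟩ := h
    obtain ⟨σ', τ', hle, hj, rfl⟩ := ih
    refine ⟨Function.update σ' τ' e, τ' + 1, by omega, fun j hlt => ?_, ?_⟩
    · rw [Function.update_of_ne (by omega), hj j hlt]
    · simp only [run, Function.update_self]
      rw [run_congr (σ := σ') fun j hj => Function.update_of_ne hj.ne _ _]

theorem exists_schedule_of_reach_start {D : S.Conf} (h : S.Reach (S.start x) D) :
    ∃ σ τ, S.run x σ τ = D := by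
  obtain ⟨σ, τ, -, -, h⟩ := exists_schedule_of_reach (σ := fun _ => S.idle) (τ := 0) h
  exact ⟨σ, τ, h⟩

variable (S) in
theorem exists_frequent_enumeration :
    ∃ g : ℕ → S.Event, ∀ e T, ∃ τ, T ≤ τ ∧ g τ = e := by
  have := S.countable_event
  have : Nonempty S.Event := ⟨S.idle⟩
  obtain ⟨f, hf⟩ := exists_surjective_nat S.Event
  refine ⟨fun i => f i.unpair.1, fun e T => ?_⟩
  obtain ⟨a, rfl⟩ := hf e
  exact ⟨Nat.pair a T, Nat.right_le_pair a T, by simp⟩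

/-- Since decisions are irrevocable, there is a time from which on all of the processes that
eventually decide have decided. -/
theorem exists_forall_decision {σ : ℕ → S.Event} {s : Fin n}
    (h : ∀ p, p ≠ s → ∃ τ, S.decision (S.run x σ τ) p ≠ none) :
    ∃ T, ∀ τ, T ≤ τ → ∀ p, p ≠ s → S.decision (S.run x σ τ) p ≠ none := by
  choose! f hf using h
  refine ⟨Finset.univ.sup f, fun τ hτ p hp => ?_⟩
  obtain ⟨v, hv⟩ := Option.ne_none_iff_exists'.1 (hf p hp)
  rw [decision_of_reach (reach_run σ ((Finset.le_sup (Finset.mem_univ p)).trans hτ)) hv]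
  exact Option.some_ne_none v

/-- If every bivalent configuration can be led to a bivalent configuration by a finite sequence
of events with prescribed last event, then some schedule contains every event infinitely often
and never leaves the bivalent configurations. -/
theorem exists_fair_bivalent_schedule (h0 : S.Bivalent k (S.start x))
    (hext : ∀ C, S.Reach (S.start x) C → S.Bivalent k C → ∀ e,
      ∃ D, S.Reach C D ∧ S.Bivalent k (S.step D e)) :
    ∃ σ, (∀ e T, ∃ τ, T ≤ τ ∧ σ τ = e) ∧ ∀ τ, S.Bivalent k (S.run x σ τ) := by
  obtain ⟨g, hg⟩ := S.exists_frequent_enumeration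
  have hnext : ∀ (i : ℕ) (a : {a : (ℕ → S.Event) × ℕ // S.Bivalent k (S.run x a.1 a.2)}),
      ∃ b : {a : (ℕ → S.Event) × ℕ // S.Bivalent k (S.run x a.1 a.2)},
        (∀ j, j < a.1.2 → b.1.1 j = a.1.1 j) ∧
        ∃ m, a.1.2 ≤ m ∧ b.1.2 = m + 1 ∧ b.1.1 m = g i := by
    rintro i ⟨⟨σ, τ⟩, hb⟩
    obtain ⟨D, hD, hDb⟩ := hext _ (reach_run σ (Nat.zero_le τ)) hb (g i)
    obtain ⟨σ', τ', hle, hj, rfl⟩ := exists_schedule_of_reach hD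
    refine ⟨⟨(Function.update σ' τ' (g i), τ' + 1), ?_⟩, fun j hlt => ?_, τ', hle, rfl, ?_⟩
    · simp only [run, Function.update_self]
      rwa [run_congr (σ := σ') fun j hj => Function.update_of_ne hj.ne _ _]
    · have : j < τ := hlt
      simp only
      rw [Function.update_of_ne (by omega), hj j hlt]
    · simp
  choose next hagree m hm hm1 hlast using hnext
  let a : ℕ → {a : (ℕ → S.Event) × ℕ // S.Bivalent k (S.run x a.1 a.2)} :=
    fun i => Nat.rec ⟨(fun _ => S.idle, 0), h0⟩ next i
  have ha : ∀ i, a (i + 1) = next i (a i) := fun _ => rfl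
  have hstep : ∀ i, (a i).1.2 < (a (i + 1)).1.2 := fun i => by
    have := hm i (a i)
    rw [ha, hm1]
    omega
  have hmono : StrictMono fun i => (a i).1.2 := strictMono_nat_of_lt_succ hstep
  have hcompat : ∀ i i', i ≤ i' → ∀ j, j < (a i).1.2 → (a i').1.1 j = (a i).1.1 j := by
    intro i i' hii'
    induction i', hii' using Nat.le_induction with
    | base => exact fun _ _ => rfl
    | succ l hl ih =>
      intro j hj
      rw [ha, hagree l (a l) j (hj.trans_le (hmono.monotone hl)), ih j hj]
  -- the limit of the finite schedules, the `i`-th of which is fixed up to time `i` at least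
  let σ : ℕ → S.Event := fun τ => (a (τ + 1)).1.1 τ
  have hσ : ∀ i τ, τ < (a i).1.2 → σ τ = (a i).1.1 τ := by
    intro i τ hτ
    have h1 : τ < (a (τ + 1)).1.2 := hmono.le_apply (x := τ + 1)
    rcases le_total i (τ + 1) with h | h
    · exact hcompat _ _ h τ hτ
    · exact (hcompat _ _ h τ h1).symm
  have hrun : ∀ i, S.Bivalent k (S.run x σ (a i).1.2) := fun i => by
    rw [run_congr (hσ i)]
    exact (a i).2
  refine ⟨σ, fun e T => ?_, fun τ => ?_⟩
  · obtain ⟨i, hi, rfl⟩ := hg e T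
    have h1 : i ≤ (a i).1.2 := hmono.le_apply
    have h2 := hm i (a i)
    refine ⟨m i (a i), by omega, ?_⟩
    rw [hσ (i + 1) _ (by rw [ha, hm1]; omega), ha, hlast]
  · exact (hrun τ).of_reach (reach_run σ hmono.le_apply)

end Schedules

/-! ### Bivalence -/

section Impossibility

variable {I : Set V} {val : Validity}

theorem Solves.partiallyAgree (h : S.Solves I k val) {x : Fin n → V} (hx : ∀ p, x p ∈ I)
    {C : S.Conf} (hC : S.Reach (S.start x) C) : PartiallyAgree k val x (S.decision C) := by
  obtain ⟨σ, τ, rfl⟩ := exists_schedule_of_reach_start hC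
  exact h.agree x hx σ τ

theorem Solves.not_bivalent_of_chosen (h : S.Solves I k val) {x : Fin n → V}
    (hx : ∀ p, x p ∈ I) {C : S.Conf} (hC : S.Reach (S.start x) C) {u : V}
    (hu : Chosen k (S.decision C) u) : ¬ S.Bivalent k C := by
  have key : ∀ v, S.CanChoose k C v → v = u := by
    rintro v ⟨D, hD, hv⟩
    exact hv.unique (h.partiallyAgree hx (hC.trans hD)) (chosen_of_reach hD hu)
  rintro ⟨v, w, hne, hv, hw⟩
  exact hne ((key v hv).trans (key w hw).symm)

/-- Since the processes other than `s` must decide without `s`, they can have a value chosen,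
even disregarding the decision of `s`. -/
theorem Solves.exists_reachWithout (h : S.Solves I k val) (hk : n + 1 < 2 * k) {x : Fin n → V}
    (hx : ∀ p, x p ∈ I) {C : S.Conf} (hC : S.Reach (S.start x) C) (s : Fin n) :
    ∃ D v, S.ReachWithout s C D ∧ n < k + {p | p ≠ s ∧ S.decision D p = some v}.ncard := by
  classical
  obtain ⟨σ₀, τ₀, rfl⟩ := exists_schedule_of_reach_start hC
  obtain ⟨g, hg⟩ := S.exists_frequent_enumeration
  let σ : ℕ → S.Event := fun τ =>
    if τ < τ₀ then σ₀ τ else if S.proc (g τ) = some s then S.idle else g τ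
  have hs : ∀ τ, τ₀ ≤ τ → S.proc (σ τ) ≠ some s := by
    intro τ hτ
    simp only [σ, if_neg (not_lt.2 hτ)]
    split_ifs with h
    · simp [S.proc_idle]
    · exact h
  have hfair : S.FairExcept s σ := by
    intro e
    by_cases he : S.proc e = some s
    · exact Or.inr ⟨he, τ₀, hs⟩
    · refine Or.inl fun T => ?_
      obtain ⟨τ, hτ, rfl⟩ := hg e (max T τ₀)
      refine ⟨τ, (le_max_left _ _).trans hτ, ?_⟩
      simp only [σ, if_neg (not_lt.2 ((le_max_right _ _).trans hτ)), if_neg he]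
  obtain ⟨T, hT⟩ := exists_forall_decision (h.live x hx σ s hfair)
  obtain ⟨v, hv⟩ := exists_chosen hk (h.agree x hx σ (max T τ₀)) s (hT _ (le_max_left _ _))
  refine ⟨_, v, ?_, hv⟩
  rw [← run_congr (σ' := σ) fun j hj => if_pos hj]
  exact reachWithout_run hs (le_max_right _ _)

theorem exists_sim_of_reachWithout {s : Fin n} {Z W X : S.Conf} (h : S.ReachWithout s Z W)
    (hX : S.Sim s Z X) : ∃ Y, S.Reach X Y ∧ S.Sim s W Y := by
  induction h with
  | refl => exact ⟨X, ReflTransGen.refl, hX⟩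
  | tail _ h ih =>
    obtain ⟨e, he, rfl⟩ := h
    obtain ⟨Y, hY, hsim⟩ := ih
    obtain ⟨e', he'⟩ := S.sim_step s _ Y e hsim he
    exact ⟨_, hY.trans (reach_step Y e'), he'⟩

/-- All configurations that simulate `Z` for the processes other than `s` share a value that can
be chosen: the one that those processes choose from `Z` without `s`. -/
theorem Solves.exists_common_value (h : S.Solves I k val) (hk : n + 1 < 2 * k) {x : Fin n → V}
    (hx : ∀ p, x p ∈ I) {Z : S.Conf} (hZ : S.Reach (S.start x) Z) (s : Fin n) :
    ∃ v, ∀ X, S.Sim s Z X → S.CanChoose k X v := by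
  obtain ⟨D, v, hD, hv⟩ := h.exists_reachWithout hk hx hZ s
  refine ⟨v, fun X hX => ?_⟩
  obtain ⟨Y, hY, hsim⟩ := exists_sim_of_reachWithout hD hX
  refine ⟨Y, hY, lt_of_lt_of_le hv (Nat.add_le_add_left (Set.ncard_le_ncard ?_) k)⟩
  rintro p ⟨hps, hp⟩
  rw [Set.mem_ofPred_eq, ← S.sim_decision s D Y p hsim hps, hp]

/-- From a bivalent configuration, the event `e` can be scheduled, after finitely many others, so
as to keep the configuration bivalent. Otherwise, by `local_sim`, the value that can be chosen
after `e` would be the same whatever precedes `e`, contrary to bivalence. -/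
theorem Solves.exists_bivalent_step (h : S.Solves I k val) (hk : n + 1 < 2 * k) {x : Fin n → V}
    (hx : ∀ p, x p ∈ I) {C : S.Conf} (hC : S.Reach (S.start x) C) (hb : S.Bivalent k C)
    (e : S.Event) : ∃ D, S.Reach C D ∧ S.Bivalent k (S.step D e) := by
  by_contra! hcon
  have hloc : ∀ D, S.Reach C D → ∀ f, ∃ v,
      S.CanChoose k (S.step D e) v ∧ S.CanChoose k (S.step (S.step D f) e) v := by
    intro D hD f
    obtain ⟨s, Z, X, Y, hZ, hX, hY, hZX, hZY⟩ := S.local_sim D e f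
    obtain ⟨v, hv⟩ := h.exists_common_value hk hx ((hC.trans hD).trans hZ) s
    exact ⟨v, (hv X hZX).of_reach hX, (hv Y hZY).of_reach hY⟩
  have huniq : ∀ D, S.Reach C D → ∀ v w, S.CanChoose k (S.step D e) v →
      S.CanChoose k (S.step D e) w → v = w := by
    intro D hD v w hv hw
    by_contra hne
    exact hcon D hD ⟨v, w, hne, hv, hw⟩
  -- the unique value that can be chosen after `e` does not depend on what precedes `e`
  obtain ⟨u, hu, -⟩ := hloc C ReflTransGen.refl S.idle
  have hall : ∀ D, S.Reach C D → S.CanChoose k (S.step D e) u := by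
    intro D hD
    induction hD with
    | refl => exact hu
    | @tail D' _ hD' hstep ih =>
      obtain ⟨f, rfl⟩ := hstep
      obtain ⟨v, hv, hv'⟩ := hloc D' hD' f
      rwa [huniq D' hD' u v ih hv]
  have hval : ∀ v, S.CanChoose k C v → v = u := by
    rintro v ⟨W, hW, hv⟩
    exact huniq W hW v u ⟨_, ReflTransGen.refl, chosen_of_reach (reach_step W e) hv⟩ (hall W hW)
  obtain ⟨v, w, hne, hv, hw⟩ := hb
  exact hne ((hval v hv).trans (hval w hw).symm)

/-- If all inputs are `a`, only `a` can be chosen, and likewise for `b`. Inputs that differ at one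
process only share a value that can be chosen, so between these extremes some start is bivalent. -/
theorem Solves.exists_bivalent_start (h : S.Solves I k val) (hk : n + 1 < 2 * k) (hn : 0 < n)
    {a b : V} (ha : a ∈ I) (hb : b ∈ I) (hab : a ≠ b) :
    ∃ x : Fin n → V, (∀ p, x p ∈ I) ∧ S.Bivalent k (S.start x) := by
  by_contra! hcon
  -- the inputs change from `a` to `b` one process at a time
  let x : ℕ → Fin n → V := fun j p => if p.1 < j then b else a
  have hx : ∀ j p, x j p ∈ I := by
    intro j p
    simp only [x]
    split_ifs <;> assumption
  have hinput : ∀ j v, S.CanChoose k (S.start (x j)) v → ∃ p, x j p = v := by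
    rintro j v ⟨D, hD, hv⟩
    exact hv.exists_input (h.partiallyAgree (hx j) hD)
  have hcan : ∀ j, j ≤ n → S.CanChoose k (S.start (x j)) a := by
    intro j
    induction j with
    | zero =>
      intro _
      obtain ⟨v, hv⟩ := h.exists_common_value hk (hx 0) ReflTransGen.refl ⟨0, hn⟩
      have hv0 := hv _ (S.sim_start ⟨0, hn⟩ (x 0) (x 0) fun _ _ => rfl)
      obtain ⟨p, hp⟩ := hinput 0 v hv0
      have hva : a = v := by simpa [x] using hp
      rwa [hva]
    | succ j ih =>
      intro hj
      obtain ⟨v, hv⟩ := h.exists_common_value hk (hx j) ReflTransGen.refl ⟨j, hj⟩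
      have hv0 := hv _ (S.sim_start ⟨j, hj⟩ (x j) (x j) fun _ _ => rfl)
      have hv1 := hv _ (S.sim_start ⟨j, hj⟩ (x j) (x (j + 1)) fun p hp => by
        have hne : p.1 ≠ j := fun h => hp (Fin.ext h)
        have hiff : p.1 < j ↔ p.1 < j + 1 := by omega
        simp only [x, hiff])
      have hva : a = v := by
        by_contra hne
        exact hcon (x j) (hx j) ⟨a, v, hne, ih (by omega), hv0⟩
      rwa [hva]
  obtain ⟨p, hp⟩ := hinput n a (hcan n le_rfl)
  exact hab (by simpa [x] using hp.symm)

/-- In a fair schedule that stays bivalent forever, all processes but one decide, which makes a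
value chosen and thereby ends bivalence. -/
theorem not_solves (hk : n + 1 < 2 * k) (hn : 0 < n) {a b : V} (ha : a ∈ I) (hb : b ∈ I)
    (hab : a ≠ b) : ¬ S.Solves I k val := by
  intro h
  obtain ⟨x, hx, hbiv⟩ := h.exists_bivalent_start hk hn ha hb hab
  obtain ⟨σ, hfair, hσ⟩ := exists_fair_bivalent_schedule hbiv
    fun C hC hCb e => h.exists_bivalent_step hk hx hC hCb e
  obtain ⟨T, hT⟩ := exists_forall_decision (h.live x hx σ ⟨0, hn⟩ fun e => Or.inl (hfair e))
  obtain ⟨v, hv⟩ := exists_chosen hk (h.agree x hx σ T) ⟨0, hn⟩ (hT T le_rfl)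
  refine h.not_bivalent_of_chosen hx (reach_run σ (Nat.zero_le T)) (u := v) ?_ (hσ T)
  exact lt_of_lt_of_le hv (Nat.add_le_add_left (Set.ncard_le_ncard fun p hp => hp.2) k)

end Impossibility

end AsyncSystem

/-- Resilience to `t ≥ 1` crashes, where nobody but `s` can have crashed. -/
theorem Execution.decides_of_crashes_subset {n t : ℕ} {V : Type u} {E : Execution n V}
    (ht : 1 ≤ t) (h : E.Resilient t) {s : Fin n} (hs : ∀ p, E.Crashes p → p = s) {p : Fin n}
    (hp : p ≠ s) : ∃ τ, E.decision τ p ≠ none := by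
  have hcard : {p | E.Crashes p}.ncard ≤ t := by
    have h1 : {p | E.Crashes p} ⊆ {s} := fun q hq => hs q hq
    have h2 := Set.ncard_le_ncard h1
    rw [Set.ncard_singleton] at h2
    omega
  obtain ⟨τ, v, hv⟩ := h hcard p fun hc => hp (hs p hc)
  exact ⟨τ, by rw [hv]; exact Option.some_ne_none v⟩

/-! ### Read/write shared memory -/

namespace RWAlgorithm

variable {n : ℕ} {V : Type u} {A : RWAlgorithm.{u, w} n V}

/-- The configurations agree except for the local state of `s`. -/
def SimExcept (s : Fin n) (C D : A.Config) : Prop :=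
  (∀ p, p ≠ s → C.status p = D.status p) ∧ C.mem = D.mem

/-- The next step of `p` is to write `a` to the register `r`. -/
def Writes (C : A.Config) (p : Fin n) (r : A.Reg) (a : A.Val) : Prop :=
  ∃ s s', C.status p = .running s ∧ A.code p s = .write r a s'

theorem SimExcept.refl (s : Fin n) (C : A.Config) : SimExcept s C C :=
  ⟨fun _ _ => rfl, rfl⟩

theorem status_step_of_ne {C : A.Config} {p q : Fin n} (h : q ≠ p) :
    (A.step C p).status q = C.status q := by
  unfold step
  split
  · rfl
  · split <;> simp [Function.update_of_ne h]

theorem status_step_of_returned {C : A.Config} {p q : Fin n} {v : V}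
    (h : C.status p = .returned v) : (A.step C q).status p = .returned v := by
  by_cases hpq : p = q
  · subst hpq
    unfold step
    rw [h]
    exact h
  · rw [status_step_of_ne hpq, h]

theorem SimExcept.step {s p : Fin n} {C D : A.Config} (h : SimExcept s C D) (hp : p ≠ s) :
    SimExcept s (A.step C p) (A.step D p) := by
  obtain ⟨h1, h2⟩ := h
  unfold RWAlgorithm.step
  rw [← h1 p hp, ← h2]
  split
  · exact ⟨h1, h2⟩
  · split <;> refine ⟨fun q hq => ?_, by simp [h2]⟩ <;>
      by_cases hqp : q = p <;> simp [hqp, h1 q hq]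

/-- A step that does not write is imperceptible to the other processes. -/
theorem simExcept_step {C : A.Config} {p : Fin n} (h : ∀ r a, ¬ Writes C p r a) :
    SimExcept p C (A.step C p) := by
  refine ⟨fun q hq => (status_step_of_ne hq).symm, ?_⟩
  unfold step
  split
  · rfl
  · rename_i s hs
    split
    · rfl
    · rename_i r a s' hc
      exact (h r a ⟨s, s', hs, hc⟩).elim
    · rfl

open Classical in
theorem Writes.mem_step {C : A.Config} {p : Fin n} {r : A.Reg} {a : A.Val}
    (h : Writes C p r a) : (A.step C p).mem = Function.update C.mem r a := by
  obtain ⟨s, s', h1, h2⟩ := h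
  unfold step
  rw [h1]
  simp only [h2]

theorem writes_congr {C D : A.Config} {p : Fin n} (h : C.status p = D.status p) (r : A.Reg)
    (a : A.Val) : Writes C p r a ↔ Writes D p r a := by
  unfold Writes
  rw [h]

theorem Writes.status_step {C D : A.Config} {p : Fin n} {r : A.Reg} {a : A.Val}
    (h : Writes C p r a) (hD : C.status p = D.status p) :
    (A.step C p).status p = (A.step D p).status p := by
  obtain ⟨s, s', h1, h2⟩ := h
  unfold step
  rw [← hD, h1]
  simp only [h2, Function.update_self]

/-- Steps of different processes `p` and `q` can be exchanged, up to the local state of a process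
that the others cannot perceive. If one of them does not write, nobody else notices that it took
its step; of two writes to the same register the second covers the first; writes to different
registers commute. -/
theorem exists_simExcept (D : A.Config) {p q : Fin n} (hpq : p ≠ q) :
    (∃ s, SimExcept s (A.step D q) (A.step (A.step D p) q) ∧
      SimExcept s (A.step D q) (A.step (A.step D q) p)) ∨
    (∃ s, SimExcept s (A.step D p) (A.step (A.step D q) p)) ∨
    A.step (A.step D p) q = A.step (A.step D q) p := by
  classical
  by_cases hp : ∃ r a, Writes D p r a
  swap
  · push Not at hp
    refine Or.inl ⟨p, (simExcept_step hp).step hpq.symm, simExcept_step fun r a => ?_⟩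
    rw [writes_congr (status_step_of_ne hpq)]
    exact hp r a
  by_cases hq : ∃ r a, Writes D q r a
  swap
  · push Not at hq
    exact Or.inr (Or.inl ⟨q, (simExcept_step hq).step hpq⟩)
  obtain ⟨r, a, hp⟩ := hp
  obtain ⟨r', a', hq⟩ := hq
  have hp' : Writes (A.step D q) p r a := (writes_congr (status_step_of_ne hpq) r a).2 hp
  have hq' : Writes (A.step D p) q r' a' :=
    (writes_congr (status_step_of_ne hpq.symm) r' a').2 hq
  have hps := hp.status_step (D := A.step D q) (status_step_of_ne hpq).symm
  have hqs := hq.status_step (D := A.step D p) (status_step_of_ne hpq.symm).symm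
  have hmem : (A.step (A.step D q) p).mem =
      Function.update (Function.update D.mem r' a') r a := by
    rw [hp'.mem_step, hq.mem_step]
  by_cases hr : r = r'
  · subst hr
    refine Or.inr (Or.inl ⟨q, fun z hz => ?_, ?_⟩)
    · by_cases hzp : z = p
      · subst hzp
        exact hps
      · rw [status_step_of_ne hzp, status_step_of_ne hzp, status_step_of_ne hz]
    · rw [hmem, hp.mem_step, Function.update_idem]
  · refine Or.inr (Or.inr ?_)
    have hmem' : (A.step (A.step D p) q).mem = (A.step (A.step D q) p).mem := by
      rw [hmem, hq'.mem_step, hp.mem_step, Function.update_comm hr]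
    have hstatus : (A.step (A.step D p) q).status = (A.step (A.step D q) p).status := by
      funext z
      by_cases hzp : z = p
      · subst hzp
        rw [status_step_of_ne hpq, hps]
      · by_cases hzq : z = q
        · subst hzq
          rw [status_step_of_ne hzp, hqs]
        · rw [status_step_of_ne hzq, status_step_of_ne hzp, status_step_of_ne hzp,
            status_step_of_ne hzq]
    calc A.step (A.step D p) q
        = ⟨(A.step (A.step D p) q).status, (A.step (A.step D p) q).mem⟩ := rfl
      _ = _ := by rw [hmem', hstatus]

/-- A step in which process `p` is scheduled, or nobody. -/
noncomputable def optionStep (A : RWAlgorithm.{u, w} n V) (C : A.Config) :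
    Option (Fin n) → A.Config
  | none => C
  | some p => A.step C p

open Relation in
/-- A shared memory algorithm as an asynchronous system. -/
noncomputable def toAsyncSystem (A : RWAlgorithm.{u, w} n V) (hn : 0 < n) :
    AsyncSystem.{u, max u w} n V where
  Conf := A.Config
  Event := Option (Fin n)
  idle := none
  proc := id
  start := A.startConfig
  step := A.optionStep
  decision C p := (C.status p).decision
  Sim := SimExcept
  countable_event := inferInstance
  proc_idle := rfl
  decision_step C e p v h := by
    cases e with
    | none => exact h
    | some q =>
      cases hs : C.status p with
      | running s => simp [hs, Status.decision] at h
      | returned v' =>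
        rw [optionStep, status_step_of_returned hs, ← hs, h]
  sim_start s x y h := ⟨fun p hp => by simp [startConfig, h p hp], rfl⟩
  sim_step s Z X e h he := by
    cases e with
    | none => exact ⟨none, h⟩
    | some p => exact ⟨some p, h.step fun hp => he (by rw [hp]; rfl)⟩
  sim_decision s Z X p h hp := by rw [h.1 p hp]
  local_sim D e f := by
    have hstep : ∀ (C : A.Config) (e : Option (Fin n)),
        ReflTransGen (fun C C' => ∃ g, A.optionStep C g = C') C (A.optionStep C e) :=
      fun C e => ReflTransGen.single ⟨e, rfl⟩
    cases e with
    | none =>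
      exact ⟨⟨0, hn⟩, _, _, _, hstep D f, hstep D f, .refl, SimExcept.refl _ _,
        SimExcept.refl _ _⟩
    | some p =>
      by_cases hf : f = some p
      · subst hf
        exact ⟨p, _, _, _, (hstep D _).trans (hstep _ _), hstep _ (some p), .refl,
          SimExcept.refl _ _, SimExcept.refl _ _⟩
      cases f with
      | none => exact ⟨p, _, _, _, hstep D _, .refl, .refl, SimExcept.refl _ _,
          SimExcept.refl _ _⟩
      | some q =>
        have hpq : p ≠ q := fun h => hf (by rw [h])
        obtain ⟨s, h1, h2⟩ | ⟨s, h⟩ | h := exists_simExcept D hpq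
        · exact ⟨s, _, _, _, hstep D (some q), hstep _ (some q), .refl, h1, h2⟩
        · exact ⟨s, _, _, _, hstep D (some p), .refl, .refl, SimExcept.refl _ _, h⟩
        · refine ⟨p, _, _, _, (hstep D (some q)).trans (hstep _ (some p)), hstep _ (some q),
            .refl, ?_, SimExcept.refl _ _⟩
          simp only [optionStep, h]
          exact SimExcept.refl _ _

theorem config_succ (x : Fin n → V) (σ : ℕ → Option (Fin n)) (τ : ℕ) :
    A.config x σ (τ + 1) = A.optionStep (A.config x σ τ) (σ τ) := by
  rw [config]
  cases σ τ <;> rfl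

theorem run_toAsyncSystem (hn : 0 < n) (x : Fin n → V)
    (σ : ℕ → (A.toAsyncSystem hn).Event) (τ : ℕ) :
    (A.toAsyncSystem hn).run x σ τ = A.config x σ τ := by
  induction τ with
  | zero => rfl
  | succ τ ih =>
    change A.optionStep ((A.toAsyncSystem hn).run x σ τ) (σ τ) = _
    rw [ih]
    exact (config_succ x σ τ).symm

theorem SolvesPartialAgreement.solves {I : Set V} {t k : ℕ} {val : Validity}
    (h : A.SolvesPartialAgreement I t k val) (hn : 0 < n) (ht : 1 ≤ t) :
    (A.toAsyncSystem hn).Solves I k val where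
  agree x hx σ τ := by
    rw [run_toAsyncSystem]
    exact (h x hx σ).1 τ
  live x hx σ s hfair p hp := by
    simp only [run_toAsyncSystem]
    refine Execution.decides_of_crashes_subset ht (h x hx σ).2 (fun q hq => ?_) hp
    obtain ⟨-, T, hT⟩ := hq
    obtain hinf | ⟨hqs, -⟩ := hfair (some q)
    · obtain ⟨τ, hτ, he⟩ := hinf T
      exact (hT τ hτ he).elim
    · exact Option.some_injective _ hqs

end RWAlgorithm

/-! ### Message passing -/

namespace MPAlgorithm

variable {n : ℕ} {V : Type u} {A : MPAlgorithm.{u, w} n V}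

/-- From `D` the processes other than `s` can do whatever they can do, without `s`, from `C`:
their statuses and the messages they sent are the same, `s` sent in `D` the messages that it sent
in `C` and possibly more, and the messages received are the same, disregarding those to `s` and
those that `s` sent only in `D`. -/
structure SimExcept (s : Fin n) (C D : A.Config) : Prop where
  status : ∀ p, p ≠ s → C.status p = D.status p
  sent : ∀ p, p ≠ s → C.sent p = D.sent p
  prefix_sent : C.sent s <+: D.sent s
  received : ∀ id : MsgId n, (id.1 ≠ s ∨ id.2 < (C.sent id.1).length) →
    (∀ a, (C.sent id.1)[id.2]? ≠ some (s, a)) → (id ∈ C.received ↔ id ∈ D.received)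

theorem SimExcept.refl (s : Fin n) (C : A.Config) : SimExcept s C C :=
  ⟨fun _ _ => rfl, fun _ _ => rfl, List.prefix_rfl, fun _ _ _ => Iff.rfl⟩

theorem delivery_eq_some {C : A.Config} {p : Fin n} {o : Option (MsgId n)} {a : A.Msg} :
    C.delivery p o = some a ↔
      ∃ id, o = some id ∧ id ∉ C.received ∧ (C.sent id.1)[id.2]? = some (p, a) := by
  cases o with
  | none => simp [Config.delivery]
  | some id =>
    simp only [Config.delivery, Option.some.injEq, exists_eq_left']
    split_ifs with h
    · simp [h]
    · simp only [h, not_false_eq_true, true_and, Option.bind_eq_some_iff]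
      constructor
      · rintro ⟨⟨q, b⟩, h1, h2⟩
        split_ifs at h2 with hq
        simp only at hq h2
        rw [h1, hq, Option.some_injective _ h2]
      · intro h1
        exact ⟨(p, a), h1, by simp⟩

theorem step_of_returned {C : A.Config} {p : Fin n} {v : V} (o : Option (MsgId n))
    (h : C.status p = .returned v) : A.step C p o = C := by
  unfold step
  rw [h]

theorem status_step_of_ne {C : A.Config} {p q : Fin n} (o : Option (MsgId n)) (h : q ≠ p) :
    (A.step C p o).status q = C.status q := by
  unfold step
  split
  · rfl
  · simp [Function.update_of_ne h]

theorem sent_step_of_ne {C : A.Config} {p q : Fin n} (o : Option (MsgId n)) (h : q ≠ p) :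
    (A.step C p o).sent q = C.sent q := by
  unfold step
  split
  · rfl
  · simp [Function.update_of_ne h]

theorem prefix_sent_step (C : A.Config) (p q : Fin n) (o : Option (MsgId n)) :
    C.sent q <+: (A.step C p o).sent q := by
  by_cases h : q = p
  · subst h
    unfold step
    split
    · exact List.prefix_rfl
    · simp
  · rw [sent_step_of_ne o h]

theorem mem_received_step {C : A.Config} {p : Fin n} {st : A.State} {o : Option (MsgId n)}
    (h : C.status p = .running st) (id : MsgId n) :
    id ∈ (A.step C p o).received ↔
      id ∈ C.received ∨ (o = some id ∧ ∃ a, C.delivery p o = some a) := by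
  unfold step
  rw [h]
  simp only
  split
  · rename_i a id' h1
    simp only [Finset.mem_insert, Option.some.injEq]
    constructor
    · rintro (rfl | h2)
      · exact Or.inr ⟨rfl, a, h1⟩
      · exact Or.inl h2
    · rintro (h2 | ⟨rfl, -⟩)
      · exact Or.inr h2
      · exact Or.inl rfl
  · rename_i hno
    constructor
    · exact Or.inl
    · rintro (h2 | ⟨h2, a, h3⟩)
      · exact h2
      · exact (hno a id h3 h2).elim

theorem getElem?_sent_step {C : A.Config} {q : Fin n} {i : ℕ} {m : Fin n × A.Msg}
    (h : (C.sent q)[i]? = some m) (p : Fin n) (o : Option (MsgId n)) :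
    ((A.step C p o).sent q)[i]? = some m := by
  obtain ⟨l, hl⟩ := prefix_sent_step C p q o
  rw [← hl, List.getElem?_append_left (List.getElem?_eq_some_iff.1 h).1, h]

theorem SimExcept.getElem?_sent {s : Fin n} {C D : A.Config} (h : SimExcept s C D) {q : Fin n}
    {i : ℕ} (hi : q ≠ s ∨ i < (C.sent q).length) : (D.sent q)[i]? = (C.sent q)[i]? := by
  by_cases hq : q = s
  · subst hq
    obtain ⟨l, hl⟩ := h.prefix_sent
    rw [← hl, List.getElem?_append_left (hi.resolve_left fun hne => hne rfl)]
  · rw [h.sent q hq]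

/-- Steps with the same delivery to a process that does not perceive the difference preserve the
simulation. -/
theorem SimExcept.step_of_delivery {s p : Fin n} {C D : A.Config} (h : SimExcept s C D)
    (hp : p ≠ s) {o o' : Option (MsgId n)} (hd : C.delivery p o = D.delivery p o')
    (ho : ∀ a, C.delivery p o = some a → o = o') :
    SimExcept s (A.step C p o) (A.step D p o') := by
  cases hs : C.status p with
  | returned v => rwa [step_of_returned o hs, step_of_returned o' ((h.status p hp).symm.trans hs)]
  | running st =>
    have hs' : D.status p = .running st := (h.status p hp).symm.trans hs
    refine ⟨fun q hq => ?_, fun q hq => ?_, ?_, fun id h1 h2 => ?_⟩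
    · by_cases hqp : q = p
      · subst hqp
        simp [step, hs, hs', hd]
      · rw [status_step_of_ne o hqp, status_step_of_ne o' hqp, h.status q hq]
    · by_cases hqp : q = p
      · subst hqp
        simp [step, hs, hs', hd, h.sent q hq]
      · rw [sent_step_of_ne o hqp, sent_step_of_ne o' hqp, h.sent q hq]
    · rw [sent_step_of_ne o hp.symm, sent_step_of_ne o' hp.symm]
      exact h.prefix_sent
    · rw [mem_received_step hs, mem_received_step hs', h.received id]
      · refine or_congr_right ⟨?_, ?_⟩
        · rintro ⟨h3, a, h4⟩
          exact ⟨(ho a h4).symm.trans h3, a, hd.symm.trans h4⟩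
        · rintro ⟨h3, a, h4⟩
          exact ⟨(ho a (hd.trans h4)).trans h3, a, hd.trans h4⟩
      · by_cases hid : id.1 = s
        · rwa [sent_step_of_ne o (hid ▸ hp.symm)] at h1
        · exact Or.inl hid
      · exact fun a ha => h2 a (getElem?_sent_step ha p o)

theorem SimExcept.exists_step {s p : Fin n} {C D : A.Config} (h : SimExcept s C D) (hp : p ≠ s)
    (o : Option (MsgId n)) : ∃ o', SimExcept s (A.step C p o) (A.step D p o') := by
  cases hd : C.delivery p o with
  | none =>
    refine ⟨none, h.step_of_delivery hp hd fun a ha => ?_⟩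
    rw [hd] at ha
    simp at ha
  | some a =>
    refine ⟨o, h.step_of_delivery hp ?_ fun _ _ => rfl⟩
    obtain ⟨id, rfl, h1, h2⟩ := delivery_eq_some.1 hd
    rw [hd, eq_comm, delivery_eq_some]
    refine ⟨id, rfl, ?_, ?_⟩
    · rwa [← h.received id (Or.inr (List.getElem?_eq_some_iff.1 h2).1)]
      intro b hb
      rw [h2] at hb
      simp only [Option.some.injEq, Prod.mk.injEq] at hb
      exact hp hb.1
    · rw [h.getElem?_sent (Or.inr (List.getElem?_eq_some_iff.1 h2).1), h2]

/-- A step of `s` only adds messages, which the simulation does not make use of. -/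
theorem SimExcept.step_right {s : Fin n} {C D : A.Config} (h : SimExcept s C D)
    (o : Option (MsgId n)) : SimExcept s C (A.step D s o) := by
  cases hs : D.status s with
  | returned v => rwa [step_of_returned o hs]
  | running st =>
    refine ⟨fun q hq => ?_, fun q hq => ?_, ?_, fun id h1 h2 => ?_⟩
    · rw [status_step_of_ne o hq, h.status q hq]
    · rw [sent_step_of_ne o hq, h.sent q hq]
    · exact h.prefix_sent.trans (prefix_sent_step D s s o)
    · rw [mem_received_step hs, h.received id h1 h2, or_iff_left]
      rintro ⟨rfl, a, ha⟩
      obtain ⟨id', hid, -, h3⟩ := delivery_eq_some.1 ha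
      obtain rfl := Option.some_injective _ hid
      exact h2 a (by rw [← h.getElem?_sent h1, h3])

/-- A step in which a process is scheduled, or nobody. -/
def optionStep (A : MPAlgorithm.{u, w} n V) (C : A.Config) :
    Option (Fin n × Option (MsgId n)) → A.Config
  | none => C
  | some (p, o) => A.step C p o

open Relation in
/-- A message passing algorithm as an asynchronous system. -/
def toAsyncSystem (A : MPAlgorithm.{u, w} n V) (hn : 0 < n) :
    AsyncSystem.{u, max u w} n V where
  Conf := A.Config
  Event := Option (Fin n × Option (MsgId n))
  idle := none
  proc e := e.map Prod.fst
  start := A.startConfig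
  step := A.optionStep
  decision C p := (C.status p).decision
  Sim := SimExcept
  countable_event := inferInstance
  proc_idle := rfl
  decision_step C e p v h := by
    cases e with
    | none => exact h
    | some qo =>
      obtain ⟨q, o⟩ := qo
      by_cases hpq : p = q
      · subst hpq
        cases hs : C.status p with
        | running s => simp [hs, Status.decision] at h
        | returned v' => rwa [optionStep, step_of_returned o hs]
      · rwa [optionStep, status_step_of_ne o hpq]
  sim_start s x y h :=
    ⟨fun p hp => by simp [startConfig, h p hp], fun _ _ => rfl, List.prefix_rfl,
      fun _ _ _ => Iff.rfl⟩
  sim_step s Z X e h he := by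
    cases e with
    | none => exact ⟨none, h⟩
    | some po =>
      obtain ⟨p, o⟩ := po
      obtain ⟨o', ho'⟩ := h.exists_step (p := p) (fun hp => he (by simp [hp])) o
      exact ⟨some (p, o'), ho'⟩
  sim_decision s Z X p h hp := by rw [h.status p hp]
  local_sim D e f := by
    have hstep : ∀ (C : A.Config) (e : Option (Fin n × Option (MsgId n))),
        ReflTransGen (fun C C' => ∃ g, A.optionStep C g = C') C (A.optionStep C e) :=
      fun C e => ReflTransGen.single ⟨e, rfl⟩
    cases e with
    | none =>
      exact ⟨⟨0, hn⟩, _, _, _, hstep D f, hstep D f, .refl, SimExcept.refl _ _,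
        SimExcept.refl _ _⟩
    | some po =>
      obtain ⟨p, o⟩ := po
      have hp := (SimExcept.refl p D).step_right o
      cases f with
      | none => exact ⟨p, _, _, _, .refl, .refl, .refl, hp, hp⟩
      | some qo =>
        obtain ⟨q, o'⟩ := qo
        by_cases hqp : q = p
        · subst hqp
          exact ⟨q, _, _, _, .refl, .refl, .refl, hp,
            ((SimExcept.refl q D).step_right o').step_right o⟩
        · -- the step of `q` can still be taken after that of `p`
          obtain ⟨o'', ho''⟩ := hp.exists_step hqp o'
          exact ⟨p, _, _, _, hstep D (some (q, o')), hstep _ (some (q, o'')), .refl, ho'',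
            (SimExcept.refl p _).step_right o⟩

theorem config_succ (x : Fin n → V) (σ : ℕ → Option (Fin n × Option (MsgId n))) (τ : ℕ) :
    A.config x σ (τ + 1) = A.optionStep (A.config x σ τ) (σ τ) := by
  rw [config]
  cases σ τ <;> rfl

theorem run_toAsyncSystem (hn : 0 < n) (x : Fin n → V)
    (σ : ℕ → (A.toAsyncSystem hn).Event) (τ : ℕ) :
    (A.toAsyncSystem hn).run x σ τ = A.config x σ τ := by
  induction τ with
  | zero => rfl
  | succ τ ih =>
    change A.optionStep ((A.toAsyncSystem hn).run x σ τ) (σ τ) = _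
    rw [ih]
    exact (config_succ x σ τ).symm

theorem getElem?_sent_of_le {x : Fin n → V} {σ : ℕ → Option (Fin n × Option (MsgId n))}
    {τ τ' : ℕ} (h : τ ≤ τ') {id : MsgId n} {m : Fin n × A.Msg}
    (hm : ((A.config x σ τ).sent id.1)[id.2]? = some m) :
    ((A.config x σ τ').sent id.1)[id.2]? = some m := by
  induction τ', h using Nat.le_induction with
  | base => exact hm
  | succ j _ ih =>
    rw [config]
    split
    · exact ih
    · exact getElem?_sent_step ih _ _

/-- A message in transit to `p` is received when `p` is scheduled to receive it, unless it was
received before or `p` has returned. -/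
theorem decides_or_received {x : Fin n → V} {σ : ℕ → Option (Fin n × Option (MsgId n))}
    {τ τ' : ℕ} (h : τ ≤ τ') {id : MsgId n} {p : Fin n} (hid : (A.config x σ τ).InTransit id p)
    (hσ : σ τ' = some (p, some id)) :
    (A.execution x σ).Decides p ∨ ∃ τ'', id ∈ (A.config x σ τ'').received := by
  obtain ⟨-, a, ha⟩ := hid
  have ha' := getElem?_sent_of_le h ha
  cases hs : (A.config x σ τ').status p with
  | returned v => exact Or.inl ⟨τ', v, by simp [execution, hs, Status.decision]⟩
  | running st =>
    by_cases hrec : id ∈ (A.config x σ τ').received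
    · exact Or.inr ⟨τ', hrec⟩
    · refine Or.inr ⟨τ' + 1, ?_⟩
      rw [config, hσ]
      exact (mem_received_step hs id).2
        (Or.inr ⟨rfl, a, delivery_eq_some.2 ⟨id, rfl, hrec, ha'⟩⟩)

theorem SolvesPartialAgreement.solves {I : Set V} {t k : ℕ} {val : Validity}
    (h : A.SolvesPartialAgreement I t k val) (hn : 0 < n) (ht : 1 ≤ t) :
    (A.toAsyncSystem hn).Solves I k val where
  agree x hx σ τ := by
    rw [run_toAsyncSystem]
    exact (h x hx σ).1 τ
  live x hx σ s hfair p hp := by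
    simp only [run_toAsyncSystem]
    have hrel : A.Reliable x σ := by
      intro τ id q hid
      obtain hinf | ⟨hqs, T, hT⟩ := hfair (some (q, some id))
      · obtain ⟨τ', hτ', he⟩ := hinf τ
        exact Or.inr (decides_or_received hτ' hid he)
      · by_cases hdec : (A.execution x σ).Decides q
        · exact Or.inr (Or.inl hdec)
        · refine Or.inl ⟨hdec, T, fun τ' hτ' => ?_⟩
          have hq : some q = some s := hqs
          rw [hq]
          exact hT τ' hτ'
    refine Execution.decides_of_crashes_subset ht ((h x hx σ).2 hrel) (fun q hq => ?_) hp
    obtain ⟨-, T, hT⟩ := hq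
    obtain hinf | ⟨hqs, -⟩ := hfair (some (q, none))
    · obtain ⟨τ, hτ, he⟩ := hinf T
      exact (hT τ hτ (by simp [execution, he])).elim
    · exact Option.some_injective _ hqs

end MPAlgorithm

/-! ### The bound -/

theorem le_ceil_half {n k : ℕ} (h : ¬ n + 1 < 2 * k) : k ≤ ⌈(n : ℚ) / 2⌉₊ := by
  cases k with
  | zero => exact Nat.zero_le _
  | succ j =>
    rw [Nat.succ_le_iff, Nat.lt_ceil, lt_div_iff₀ two_pos]
    have : j * 2 < n := by omega
    exact_mod_cast this

theorem corollary1 (n m t k : ℕ) (hn : 2 ≤ n) (hm : 2 ≤ m) (ht : 1 ≤ t)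
    {V : Type u} (I : Finset V) (hI : I.card = m) (val : Validity) :
    ((∃ A : RWAlgorithm.{u, w} n V, A.SolvesPartialAgreement (↑I) t k val) →
      k ≤ ⌈(n : ℚ) / 2⌉₊) ∧
    ((∃ A : MPAlgorithm.{u, w} n V, A.SolvesPartialAgreement (↑I) t k val) →
      k ≤ ⌈(n : ℚ) / 2⌉₊) := by
  obtain ⟨a, ha, b, hb, hab⟩ := Finset.one_lt_card.1 (by omega : 1 < I.card)
  have hn0 : 0 < n := by omega
  constructor
  · rintro ⟨A, hA⟩
    exact le_ceil_half fun hk =>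
      AsyncSystem.not_solves hk hn0 (I := ↑I) ha hb hab (hA.solves hn0 ht)
  · rintro ⟨A, hA⟩
    exact le_ceil_half fun hk =>
      AsyncSystem.not_solves hk hn0 (I := ↑I) ha hb hab (hA.solves hn0 ht)
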